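/- Let $\mathcal O_2$ be the Cuntz algebra, i.e. the universal unital $C^*$-algebra generated by two isometries $X_1,X_2$ with $X_1X_1^*+X_2X_2^*=1$, and let $\mathcal Q_2$ be the $2$-adic ring $C^*$-algebra, i.e. the universal unital $C^*$-algebra generated by a unitary $U$ and an isometry $S_2$ with $S_2U=U^2S_2$ and $S_2S_2^*+US_2S_2^*U^*=1$. View $\mathcal O_2$ inside $\mathcal Q_2$ through the $*$-homomorphism $\iota$ with $\iota(X_1)=US_2$ and $\iota(X_2)=S_2$. All representations are unital $*$-representations on a complex Hilbert space $H$, and a representation $\rho:\mathcal Q_2\to B(H)$ extends $\pi:\mathcal O_2\to B(H)$ if $\rho\circ\iota=\pi$. A representation $\pi:\mathcal O_2\to B(H)$ is called permutative if there are an orthonormal basis $\{e_n:n\in\mathbb N\}$ of $H$ and injections $\sigma_1,\sigma_2:\mathbb N\to\mathbb N$ with $\sigma_1(\mathbb N)\cap\sigma_2(\mathbb N)=\emptyset$ and $\sigma_1(\mathbb N)\cup\sigma_2(\mathbb N)=\mathbb N$ such that $\pi(X_i)e_n=e_{\sigma_i(n)}$ for all $n\in\mathbb N$ and $i=1,2$.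 A representation $\rho:\mathcal Q_2\to B(H)$ is called permutative if there are an orthonormal basis $\{f_n:n\in\mathbb N\}$ of $H$, an injection $\sigma$ of $\mathbb N$ into itself and a bijection $\tau$ of $\mathbb N$ such that $\rho(S_2)f_n=f_{\sigma(n)}$ and $\rho(U)f_n=f_{\tau(n)}$ for all $n\in\mathbb N$. Theorem. If a permutative representation $\pi:\mathcal O_2\to B(H)$ extends to some (not necessarily permutative) representation of $\mathcal Q_2$ on $H$, then $\pi$ also has an extension to $\mathcal Q_2$ on $H$ that is permutative (with respect to some orthonormal basis of $H$, which need not be the basis that makes $\pi$ permutative). -/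

import Mathlib

open scoped ENNReal

noncomputable section

namespace TwoAdic

/-! ### Universal unital C*-algebras on two contractive generators -/

/-- A property of pairs of elements of (small) unital C*-algebras. -/
abbrev PairRelation : Type 1 := ∀ (A : Type) [CStarAlgebra A], A → A → Prop

/-- The relation forces both elements to be contractions. -/
def PairRelation.Contractive (R : PairRelation) : Prop :=
  ∀ (A : Type) [CStarAlgebra A] (a b : A), R A a b → ‖a‖ ≤ 1 ∧ ‖b‖ ≤ 1

/-- A nonzero unital C*-algebra together with a pair of elements satisfying the relation. -/
structure Realization (R : PairRelation) : Type 1 where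
  carrier : Type
  cstar : CStarAlgebra carrier
  nontrivial : Nontrivial carrier
  fst : carrier
  snd : carrier
  rel : R carrier fst snd

namespace Realization

variable {R : PairRelation}

instance (x : Realization R) : CStarAlgebra x.carrier := x.cstar

instance (x : Realization R) : Nontrivial x.carrier := x.nontrivial

end Realization

/-- The `ℓ^∞`-product of all realizations of the relation: bounded families, one element for
each realization, with the pointwise operations and the supremum norm. -/
abbrev BigProduct (R : PairRelation) : Type 1 :=
  lp (fun x : Realization R => x.carrier) ∞

/-- The family formed by the first elements of all realizations. -/
def bigFst (R : PairRelation) (hR : R.Contractive) : BigProduct R :=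
  ⟨fun x => x.fst, memℓp_infty ⟨1, by
    rintro _ ⟨x, rfl⟩
    exact (hR _ _ _ x.rel).1⟩⟩

/-- The family formed by the second elements of all realizations. -/
def bigSnd (R : PairRelation) (hR : R.Contractive) : BigProduct R :=
  ⟨fun x => x.snd, memℓp_infty ⟨1, by
    rintro _ ⟨x, rfl⟩
    exact (hR _ _ _ x.rel).2⟩⟩

instance (R : PairRelation) : CStarAlgebra (BigProduct R) where

/-- The universal unital C*-algebra generated by a pair of elements subject to the relation: the
closed unital *-subalgebra generated by the two universal families in the product of all
realizations. Its universal property is `universal_property` below. -/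
def universalSubalgebra (R : PairRelation) (hR : R.Contractive) :
    StarSubalgebra ℂ (BigProduct R) :=
  (StarAlgebra.adjoin ℂ {bigFst R hR, bigSnd R hR}).topologicalClosure

/-- The universal C*-algebra as a type. -/
abbrev Universal (R : PairRelation) (hR : R.Contractive) : Type 1 :=
  universalSubalgebra R hR

theorem isClosed_universalSubalgebra (R : PairRelation) (hR : R.Contractive) :
    IsClosed (universalSubalgebra R hR : Set (BigProduct R)) :=
  StarSubalgebra.isClosed_topologicalClosure _

instance (R : PairRelation) (hR : R.Contractive) : CStarAlgebra (Universal R hR) :=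
  haveI := isClosed_universalSubalgebra R hR
  StarSubalgebra.cstarAlgebra (universalSubalgebra R hR)

/-- The first universal generator. -/
def gen₁ (R : PairRelation) (hR : R.Contractive) : Universal R hR :=
  ⟨bigFst R hR, StarSubalgebra.le_topologicalClosure _
    (StarAlgebra.subset_adjoin ℂ _ (Set.mem_insert _ _))⟩

/-- The second universal generator. -/
def gen₂ (R : PairRelation) (hR : R.Contractive) : Universal R hR :=
  ⟨bigSnd R hR, StarSubalgebra.le_topologicalClosure _
    (StarAlgebra.subset_adjoin ℂ _ (Set.mem_insert_of_mem _ rfl))⟩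

/-- Evaluation of a bounded family at a realization. -/
def evalAt {R : PairRelation} (x : Realization R) : BigProduct R →⋆ₐ[ℂ] x.carrier where
  toFun f := f x
  map_one' := rfl
  map_mul' _ _ := rfl
  map_zero' := rfl
  map_add' _ _ := rfl
  commutes' _ := rfl
  map_star' _ := rfl

/-- *-homomorphisms between C*-algebras are continuous. -/
theorem continuous_starAlgHom {A B : Type*} [CStarAlgebra A] [CStarAlgebra B] (φ : A →⋆ₐ[ℂ] B) :
    Continuous φ :=
  AddMonoidHomClass.continuous_of_bound φ 1 fun x => by
    rw [one_mul]
    exact NonUnitalStarAlgHom.norm_apply_le φ x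

/-- Two *-homomorphisms out of the universal C*-algebra that agree on the generators are equal. -/
theorem universal_hom_ext {R : PairRelation} {hR : R.Contractive} {B : Type*} [CStarAlgebra B]
    {φ ψ : Universal R hR →⋆ₐ[ℂ] B} (h₁ : φ (gen₁ R hR) = ψ (gen₁ R hR))
    (h₂ : φ (gen₂ R hR) = ψ (gen₂ R hR)) : φ = ψ := by
  refine StarAlgHom.ext_topologicalClosure (continuous_starAlgHom φ) (continuous_starAlgHom ψ) ?_
  refine StarAlgHom.ext_adjoin ?_
  rintro ⟨x, hx⟩ h
  rcases h with rfl | rfl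
  · exact h₁
  · exact h₂

/-- The universal property: every pair satisfying the relation in a unital C*-algebra is the image
of the pair of generators under exactly one unital *-homomorphism. -/
theorem universal_property (R : PairRelation) (hR : R.Contractive) (A : Type) [CStarAlgebra A]
    (a b : A) (hab : R A a b) :
    ∃! φ : Universal R hR →⋆ₐ[ℂ] A, φ (gen₁ R hR) = a ∧ φ (gen₂ R hR) = b := by
  refine existsUnique_of_exists_of_unique ?_ fun φ ψ hφ hψ =>
    universal_hom_ext (hφ.1.trans hψ.1.symm) (hφ.2.trans hψ.2.symm)
  rcases subsingleton_or_nontrivial A with hA | hA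
  · exact ⟨{ toFun := fun _ => 0
             map_one' := Subsingleton.elim _ _
             map_mul' := fun _ _ => Subsingleton.elim _ _
             map_zero' := Subsingleton.elim _ _
             map_add' := fun _ _ => Subsingleton.elim _ _
             commutes' := fun _ => Subsingleton.elim _ _
             map_star' := fun _ => Subsingleton.elim _ _ },
      Subsingleton.elim _ _, Subsingleton.elim _ _⟩
  · exact ⟨(evalAt (R := R) ⟨A, inferInstance, hA, a, b, hab⟩).comp
      (universalSubalgebra R hR).subtype, rfl, rfl⟩

/-! ### The Cuntz algebra and the 2-adic ring C*-algebra -/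

/-- Two isometries `x₁`, `x₂` with `x₁ x₁* + x₂ x₂* = 1`. -/
structure IsCuntzPair {A : Type*} [Ring A] [StarRing A] (x₁ x₂ : A) : Prop where
  isometry₁ : star x₁ * x₁ = 1
  isometry₂ : star x₂ * x₂ = 1
  sum_range : x₁ * star x₁ + x₂ * star x₂ = 1

/-- A unitary `u` and an isometry `s` with `s u = u² s` and `s s* + u s s* u* = 1`. In a nonzero
algebra the last relation forces `s` to be a proper isometry. -/
structure IsTwoAdicPair {A : Type*} [Ring A] [StarRing A] (u s : A) : Prop where
  unitary : u ∈ unitary A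
  isometry : star s * s = 1
  comm : s * u = u ^ 2 * s
  sum_range : s * star s + u * s * star s * star u = 1

theorem norm_le_one_of_isometry {A : Type*} [CStarAlgebra A] {a : A} (h : star a * a = 1) :
    ‖a‖ ≤ 1 := by
  rcases subsingleton_or_nontrivial A with hA | hA
  · rw [Subsingleton.elim a 0, norm_zero]
    exact zero_le_one
  · have h' := CStarRing.norm_star_mul_self (x := a)
    rw [h, norm_one] at h'
    nlinarith [norm_nonneg a]

/-- The relation defining the Cuntz algebra `O₂`. -/
def cuntzRelation : PairRelation := fun _ _ x₁ x₂ => IsCuntzPair x₁ x₂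

/-- The relation defining the 2-adic ring C*-algebra `Q₂`. -/
def twoAdicRelation : PairRelation := fun _ _ u s => IsTwoAdicPair u s

theorem cuntzRelation_contractive : cuntzRelation.Contractive := fun _ _ _ _ h =>
  ⟨norm_le_one_of_isometry h.isometry₁, norm_le_one_of_isometry h.isometry₂⟩

theorem twoAdicRelation_contractive : twoAdicRelation.Contractive := fun _ _ _ _ h =>
  ⟨norm_le_one_of_isometry (Unitary.mem_iff.1 h.unitary).1, norm_le_one_of_isometry h.isometry⟩

/-- The Cuntz algebra `O₂`. -/
abbrev CuntzAlgebra : Type 1 := Universal cuntzRelation cuntzRelation_contractive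

/-- The 2-adic ring C*-algebra `Q₂`. -/
abbrev TwoAdicAlgebra : Type 1 := Universal twoAdicRelation twoAdicRelation_contractive

/-- The generating isometry `X₁` of `O₂`. -/
def cuntzX₁ : CuntzAlgebra := gen₁ cuntzRelation cuntzRelation_contractive

/-- The generating isometry `X₂` of `O₂`. -/
def cuntzX₂ : CuntzAlgebra := gen₂ cuntzRelation cuntzRelation_contractive

/-- The generating unitary `U` of `Q₂`. -/
def twoAdicU : TwoAdicAlgebra := gen₁ twoAdicRelation twoAdicRelation_contractive

/-- The generating isometry `S₂` of `Q₂`. -/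
def twoAdicS : TwoAdicAlgebra := gen₂ twoAdicRelation twoAdicRelation_contractive

theorem isCuntzPair_cuntzX : IsCuntzPair cuntzX₁ cuntzX₂ where
  isometry₁ := Subtype.ext <| Subtype.ext <| funext fun x => x.rel.isometry₁
  isometry₂ := Subtype.ext <| Subtype.ext <| funext fun x => x.rel.isometry₂
  sum_range := Subtype.ext <| Subtype.ext <| funext fun x => x.rel.sum_range

theorem isTwoAdicPair_twoAdic : IsTwoAdicPair twoAdicU twoAdicS where
  unitary := Unitary.mem_iff.2
    ⟨Subtype.ext <| Subtype.ext <| funext fun x => (Unitary.mem_iff.1 x.rel.unitary).1,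
      Subtype.ext <| Subtype.ext <| funext fun x => (Unitary.mem_iff.1 x.rel.unitary).2⟩
  isometry := Subtype.ext <| Subtype.ext <| funext fun x => x.rel.isometry
  comm := Subtype.ext <| Subtype.ext <| funext fun x => x.rel.comm
  sum_range := Subtype.ext <| Subtype.ext <| funext fun x => x.rel.sum_range

/-- If `(u, s)` satisfies the relations of `Q₂`, then `(u s, s)` satisfies those of `O₂`. -/
theorem IsTwoAdicPair.isCuntzPair {A : Type*} [Ring A] [StarRing A] {u s : A}
    (h : IsTwoAdicPair u s) : IsCuntzPair (u * s) s where
  isometry₁ := by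
    rw [star_mul, mul_assoc, ← mul_assoc (star u), (Unitary.mem_iff.1 h.unitary).1, one_mul,
      h.isometry]
  isometry₂ := h.isometry
  sum_range := by
    rw [star_mul, ← mul_assoc, add_comm]
    exact h.sum_range

/-- The realization `(u s, s)` of the Cuntz relations attached to a realization `(u, s)` of the
relations of `Q₂`. -/
def toCuntz (x : Realization twoAdicRelation) : Realization cuntzRelation where
  carrier := x.carrier
  cstar := x.cstar
  nontrivial := x.nontrivial
  fst := x.fst * x.snd
  snd := x.snd
  rel := IsTwoAdicPair.isCuntzPair x.rel

/-- Reindexing of bounded families along `toCuntz`. -/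
def reindex : BigProduct cuntzRelation →⋆ₐ[ℂ] BigProduct twoAdicRelation where
  toFun f := ⟨fun x => f (toCuntz x), memℓp_infty ⟨‖f‖, by
    rintro _ ⟨x, rfl⟩
    exact lp.norm_apply_le_norm ENNReal.top_ne_zero f (toCuntz x)⟩⟩
  map_one' := rfl
  map_mul' _ _ := rfl
  map_zero' := rfl
  map_add' _ _ := rfl
  commutes' _ := rfl
  map_star' _ := rfl

theorem reindex_mem (a : CuntzAlgebra) :
    reindex (a : BigProduct cuntzRelation) ∈
      universalSubalgebra twoAdicRelation twoAdicRelation_contractive := by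
  have hmem : reindex (a : BigProduct cuntzRelation) ∈ StarSubalgebra.map reindex
      (universalSubalgebra cuntzRelation cuntzRelation_contractive) := ⟨a, a.2, rfl⟩
  have h := StarSubalgebra.map_topologicalClosure_le _ reindex (continuous_starAlgHom reindex) hmem
  refine StarSubalgebra.topologicalClosure_minimal ?_
    (isClosed_universalSubalgebra twoAdicRelation twoAdicRelation_contractive) h
  rw [StarAlgHom.map_adjoin]
  refine StarAlgebra.adjoin_le ?_
  rintro _ ⟨y, rfl | rfl, rfl⟩
  · exact (twoAdicU * twoAdicS).2
  · exact twoAdicS.2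

/-- The embedding of `O₂` into `Q₂` that sends `X₁` to `U S₂` and `X₂` to `S₂`. -/
def inclusion : CuntzAlgebra →⋆ₐ[ℂ] TwoAdicAlgebra :=
  StarAlgHom.codRestrict
    (reindex.comp (universalSubalgebra cuntzRelation cuntzRelation_contractive).subtype)
    (universalSubalgebra twoAdicRelation twoAdicRelation_contractive) reindex_mem

theorem inclusion_cuntzX₁ : inclusion cuntzX₁ = twoAdicU * twoAdicS := rfl

theorem inclusion_cuntzX₂ : inclusion cuntzX₂ = twoAdicS := rfl

/-! ### Permutative representations -/

/-- A branching function system of order two on `ℕ`: two injections whose ranges partition `ℕ`. -/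
structure IsBranchingSystem (σ₁ σ₂ : ℕ → ℕ) : Prop where
  injective₁ : Function.Injective σ₁
  injective₂ : Function.Injective σ₂
  disjoint : Disjoint (Set.range σ₁) (Set.range σ₂)
  cover : Set.range σ₁ ∪ Set.range σ₂ = Set.univ

section Representations

variable {H : Type*} [NormedAddCommGroup H] [InnerProductSpace ℂ H] [CompleteSpace H]

/-- A representation of `O₂` is permutative if the generating isometries permute the vectors of
some orthonormal basis indexed by `ℕ` according to a branching function system. -/
def IsPermutativeCuntz (π : CuntzAlgebra →⋆ₐ[ℂ] (H →L[ℂ] H)) : Prop :=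
  ∃ (e : HilbertBasis ℕ ℂ H) (σ₁ σ₂ : ℕ → ℕ), IsBranchingSystem σ₁ σ₂ ∧
    (∀ n, π cuntzX₁ (e n) = e (σ₁ n)) ∧ ∀ n, π cuntzX₂ (e n) = e (σ₂ n)

/-- A representation of `Q₂` is permutative if for some orthonormal basis indexed by `ℕ` the
isometry `S₂` acts through an injection and the unitary `U` through a bijection of the basis. -/
def IsPermutativeTwoAdic (ρ : TwoAdicAlgebra →⋆ₐ[ℂ] (H →L[ℂ] H)) : Prop :=
  ∃ (e : HilbertBasis ℕ ℂ H) (σ₂ τ : ℕ → ℕ), Function.Injective σ₂ ∧ Function.Bijective τ ∧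
    (∀ n, ρ twoAdicS (e n) = e (σ₂ n)) ∧ ∀ n, ρ twoAdicU (e n) = e (τ n)

/-- `ρ` extends `π` on the same Hilbert space, along the embedding of `O₂` into `Q₂`. -/
def Extends (ρ : TwoAdicAlgebra →⋆ₐ[ℂ] (H →L[ℂ] H)) (π : CuntzAlgebra →⋆ₐ[ℂ] (H →L[ℂ] H)) :
    Prop :=
  ρ.comp inclusion = π

end Representations

end TwoAdic

end

/-!
Write `t = u s`, so that `(t, s)` is a Cuntz pair and `u t = s u`, `u s = t`. By the first relation
the unitary `u` carries the unitary part `H₁ = ⋂ k, t ^ k H` of `t` onto the unitary part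
`H₂ = ⋂ k, s ^ k H` of `s`. Let `E` be an orthonormal basis permuted by `t` and `s`. A vector of `E`
outside `H₁` has the form `t ^ k (s e)` with `e ∈ E`, and `u` sends it to `s ^ k (t e) ∈ E`; so only
the vectors of `E` in `H₁`, and hence those in the reducing subspace generated by `H₁`, are an
obstacle. The vectors of `E` in `H₂` form an orthonormal basis of `H₂` which `s` permutes, so
applying `u⁻¹` to them gives an orthonormal basis of `H₁` which `t` permutes. Words in `t` and `s`
spread it over the reducing subspace generated by `H₁`. This subspace is orthogonal to `H₂`, so
none of the vectors of `E` in `H₂` has been replaced, and `u` permutes the new basis.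
-/

namespace TwoAdic

open scoped InnerProductSpace

section Branching

variable {α : Type*} {f g u : α → α} {C P Q : Set α} {x : α}

/-- The points lying in the range of every iterate of `f`. For a linear isometry this is the
subspace on which it acts unitarily in the Wold decomposition. -/
def iteratedRange (f : α → α) : Set α := ⋂ k, Set.range f^[k]

/-- The set of images of points of `P` under the two branches `f` and `g`. -/
def branch (f g : α → α) (P : Set α) : Set α := f '' P ∪ g '' P

/-- A set that is the union of its images under the two branches `f` and `g`. -/
def IsSelfSimilar (f g : α → α) (P : Set α) : Prop := branch f g P = P

/-- The images of points of `C` under all finite compositions of `f` and `g`, sorted by the length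
of the composition. -/
def branchHull (f g : α → α) (C : Set α) : Set α := ⋃ k, (branch f g)^[k] C

theorem antitone_range_iterate (f : α → α) : Antitone fun k => Set.range f^[k] :=
  antitone_nat_of_succ_le fun k => by
    rw [Function.iterate_succ]
    exact Set.range_comp_subset_range _ _

theorem image_iteratedRange (hf : Function.Injective f) :
    f '' iteratedRange f = iteratedRange f :=
  calc f '' ⋂ k, Set.range f^[k]
    _ = ⋂ k, Set.range f^[k + 1] := by
      simp only [hf.injOn.image_iInter_eq, Function.iterate_succ', Set.range_comp]
    _ = ⋂ k, Set.range f^[k] := (antitone_range_iterate f).iInf_nat_add 1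

theorem apply_mem_iteratedRange_iff (hf : Function.Injective f) :
    f x ∈ iteratedRange f ↔ x ∈ iteratedRange f := by
  conv_lhs => rw [← image_iteratedRange hf]
  exact hf.mem_set_image

theorem mapsTo_iteratedRange {β : Type*} {v : α → β} {g : β → β}
    (h : Function.Semiconj v f g) : Set.MapsTo v (iteratedRange f) (iteratedRange g) := by
  intro x hx
  refine Set.mem_iInter.2 fun k => ?_
  obtain ⟨y, rfl⟩ := Set.mem_iInter.1 hx k
  exact ⟨v y, (h.iterate_right k y).symm⟩

theorem monotone_branch (f g : α → α) : Monotone (branch f g) := fun _ _ h =>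
  Set.union_subset_union (Set.image_mono h) (Set.image_mono h)

theorem branch_subset_iff : branch f g P ⊆ Q ↔ Set.MapsTo f P Q ∧ Set.MapsTo g P Q := by
  simp only [branch, Set.union_subset_iff, Set.mapsTo_iff_image_subset]

theorem branch_iUnion {ι : Sort*} (P : ι → Set α) :
    branch f g (⋃ i, P i) = ⋃ i, branch f g (P i) := by
  simp only [branch, Set.image_iUnion, Set.iUnion_union_distrib]

theorem subset_branchHull : C ⊆ branchHull f g C :=
  Set.subset_iUnion (fun k => (branch f g)^[k] C) 0

theorem branchHull_subset (hC : C ⊆ P) (hf : Set.MapsTo f P P) (hg : Set.MapsTo g P P) :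
    branchHull f g C ⊆ P := by
  refine Set.iUnion_subset fun k => ?_
  induction k with
  | zero => exact hC
  | succ k ih =>
    rw [Function.iterate_succ_apply']
    exact (monotone_branch f g ih).trans (branch_subset_iff.2 ⟨hf, hg⟩)

theorem branchHull_mono (h : C ⊆ Q) : branchHull f g C ⊆ branchHull f g Q :=
  Set.iUnion_mono fun k => (monotone_branch f g).iterate k h

theorem countable_branchHull (hC : C.Countable) : (branchHull f g C).Countable := by
  refine Set.countable_iUnion fun k => ?_
  induction k with
  | zero => exact hC
  | succ k ih =>
    rw [Function.iterate_succ_apply']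
    exact (ih.image f).union (ih.image g)

theorem monotone_iterate_branch (hC : C ⊆ f '' C) :
    Monotone fun k => (branch f g)^[k] C :=
  (monotone_branch f g).monotone_iterate_of_le_map (hC.trans Set.subset_union_left)

theorem isSelfSimilar_branchHull (hC : C ⊆ f '' C) : IsSelfSimilar f g (branchHull f g C) :=
  calc branch f g (⋃ k, (branch f g)^[k] C)
    _ = ⋃ k, (branch f g)^[k + 1] C := by
      simp only [branch_iUnion, Function.iterate_succ_apply']
    _ = ⋃ k, (branch f g)^[k] C := (monotone_iterate_branch hC).iSup_nat_add 1

namespace IsSelfSimilar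

theorem symm (hP : IsSelfSimilar f g P) : IsSelfSimilar g f P := (Set.union_comm _ _).trans hP

theorem mapsTo_left (hP : IsSelfSimilar f g P) : Set.MapsTo f P P :=
  (branch_subset_iff.1 hP.subset).1

theorem mapsTo_right (hP : IsSelfSimilar f g P) : Set.MapsTo g P P :=
  hP.symm.mapsTo_left

theorem union (hP : IsSelfSimilar f g P) (hQ : IsSelfSimilar f g Q) :
    IsSelfSimilar f g (P ∪ Q) := by
  rw [IsSelfSimilar, branch, Set.image_union, Set.image_union, Set.union_union_union_comm]
  exact congrArg₂ _ hP hQ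

theorem diff (hP : IsSelfSimilar f g P) (hf : ∀ x, f x ∈ Q ↔ x ∈ Q) (hg : ∀ x, g x ∈ Q ↔ x ∈ Q) :
    IsSelfSimilar f g (P \ Q) := by
  refine Set.Subset.antisymm (branch_subset_iff.2
    ⟨fun x hx => ⟨hP.mapsTo_left hx.1, fun h => hx.2 ((hf x).1 h)⟩,
      fun x hx => ⟨hP.mapsTo_right hx.1, fun h => hx.2 ((hg x).1 h)⟩⟩) ?_
  rintro x ⟨hxP, hxQ⟩
  rcases hP.superset hxP with ⟨y, hy, rfl⟩ | ⟨y, hy, rfl⟩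
  · exact .inl ⟨y, ⟨hy, fun h => hxQ ((hf y).2 h)⟩, rfl⟩
  · exact .inr ⟨y, ⟨hy, fun h => hxQ ((hg y).2 h)⟩, rfl⟩

-- Such an `x` is `f^[k] (g y)` with `y ∈ P`, and `u` sends it to `g^[k] (f y)`.
theorem apply_mem_of_notMem_iteratedRange (hP : IsSelfSimilar f g P) (hug : ∀ x, u (g x) = f x)
    (huf : Function.Semiconj u f g) (hxP : x ∈ P) (hx : x ∉ iteratedRange f) : u x ∈ P := by
  obtain ⟨k, hk⟩ : ∃ k, x ∉ Set.range f^[k] := by simpa [iteratedRange] using hx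
  clear hx
  induction k generalizing x with
  | zero => exact absurd ⟨x, rfl⟩ hk
  | succ k ih =>
    rcases hP.superset hxP with ⟨y, hy, rfl⟩ | ⟨y, hy, rfl⟩
    · rw [huf]
      refine hP.mapsTo_right (ih hy fun ⟨z, hz⟩ => hk ⟨z, ?_⟩)
      rw [Function.iterate_succ_apply', hz]
    · rw [hug]
      exact hP.mapsTo_left hy

end IsSelfSimilar

end Branching

section HilbertBasisSet

variable {𝕜 H : Type*} [RCLike 𝕜] [NormedAddCommGroup H] [InnerProductSpace 𝕜 H]
  {B C : Set H} {u : H →L[𝕜] H} {x : H}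

variable (𝕜) in
/-- A set of vectors that, indexed by itself, is an orthonormal basis of the Hilbert space. -/
structure IsHilbertBasisSet (B : Set H) : Prop where
  orthonormal : Orthonormal 𝕜 ((↑) : B → H)
  topologicalClosure_span : (Submodule.span 𝕜 B).topologicalClosure = ⊤

theorem not_finiteDimensional_of_hilbertBasis {ι : Type*} [Infinite ι] (e : HilbertBasis ι 𝕜 H) :
    ¬ FiniteDimensional 𝕜 H :=
  fun _ => not_finite_iff_infinite.2 ‹Infinite ι› e.orthonormal.linearIndependent.finite

theorem isHilbertBasisSet_range {ι : Type*} (e : HilbertBasis ι 𝕜 H) :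
    IsHilbertBasisSet 𝕜 (Set.range e) :=
  ⟨e.orthonormal.toSubtypeRange, e.dense_span⟩

theorem mapsTo_topologicalClosure_span (hu : Set.MapsTo u B C) :
    Set.MapsTo u (Submodule.span 𝕜 B).topologicalClosure
      (Submodule.span 𝕜 C).topologicalClosure := by
  have hspan : Submodule.span 𝕜 B ≤ (Submodule.span 𝕜 C).comap (u : H →ₗ[𝕜] H) :=
    Submodule.span_le.2 fun y hy => Submodule.subset_span (hu hy)
  exact Set.MapsTo.closure hspan u.continuous

theorem ne_zero_of_mem_orthonormal (hB : Orthonormal 𝕜 ((↑) : B → H)) (hx : x ∈ B) : x ≠ 0 :=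
  hB.ne_zero ⟨x, hx⟩

theorem orthonormal_union (hB : Orthonormal 𝕜 ((↑) : B → H)) (hC : Orthonormal 𝕜 ((↑) : C → H))
    (hBC : ∀ x ∈ B, ∀ y ∈ C, ⟪x, y⟫_𝕜 = 0) : Orthonormal 𝕜 ((↑) : ↥(B ∪ C) → H) := by
  refine ⟨?_, ?_⟩
  · rintro ⟨x, hx | hx⟩
    · exact hB.1 ⟨x, hx⟩
    · exact hC.1 ⟨x, hx⟩
  · rintro ⟨x, hx | hx⟩ ⟨y, hy | hy⟩ hxy
    · exact hB.2 (i := ⟨x, hx⟩) (j := ⟨y, hy⟩) fun h =>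
          hxy (Subtype.ext (Subtype.mk.inj h))
    · exact hBC x hx y hy
    · exact inner_eq_zero_symm.1 (hBC y hy x hx)
    · exact hC.2 (i := ⟨x, hx⟩) (j := ⟨y, hy⟩) fun h =>
          hxy (Subtype.ext (Subtype.mk.inj h))

theorem orthonormal_image (hu : ∀ x y, ⟪u x, u y⟫_𝕜 = ⟪x, y⟫_𝕜)
    (hB : Orthonormal 𝕜 ((↑) : B → H)) : Orthonormal 𝕜 ((↑) : ↥(u '' B) → H) := by
  have h := (hB.comp_linearIsometry ((u : H →ₗ[𝕜] H).isometryOfInner hu)).toSubtypeRange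
  rwa [Set.range_comp, Subtype.range_coe] at h

namespace IsHilbertBasisSet

theorem infinite (hB : IsHilbertBasisSet 𝕜 B) (hH : ¬ FiniteDimensional 𝕜 H) : B.Infinite := by
  intro hfin
  have : FiniteDimensional 𝕜 (Submodule.span 𝕜 B) := FiniteDimensional.span_of_finite 𝕜 hfin
  have hspan : Submodule.span 𝕜 B = ⊤ :=
    (Submodule.closed_of_finiteDimensional _).submodule_topologicalClosure_eq.symm.trans
      hB.topologicalClosure_span
  rw [hspan] at this
  exact hH (Module.Finite.equiv Submodule.topEquiv)

variable [CompleteSpace H]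

theorem exists_hilbertBasis_range_eq {ι : Type*} (hB : IsHilbertBasisSet 𝕜 B) (φ : ι ≃ B) :
    ∃ b : HilbertBasis ι 𝕜 H, Set.range b = B := by
  have hrange : Set.range (fun i => (φ i : H)) = B := by
    rw [Set.range_comp' Subtype.val φ, φ.range_eq_univ, Set.image_univ, Subtype.range_coe]
  refine ⟨HilbertBasis.mk (hB.orthonormal.comp φ φ.injective) ?_, ?_⟩
  · exact (congrArg (fun s => (Submodule.span 𝕜 s).topologicalClosure) hrange).trans
      hB.topologicalClosure_span |>.ge
  · rwa [HilbertBasis.coe_mk]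

theorem mem_topologicalClosure_span_inter (hB : IsHilbertBasisSet 𝕜 B)
    (hx : ∀ y ∈ B \ C, ⟪y, x⟫_𝕜 = 0) : x ∈ (Submodule.span 𝕜 (B ∩ C)).topologicalClosure := by
  obtain ⟨b, hb⟩ := hB.exists_hilbertBasis_range_eq (Equiv.refl B)
  refine (Submodule.isClosed_topologicalClosure _).mem_of_tendsto (b.hasSum_repr x)
    (.of_forall fun s => Submodule.sum_mem _ fun i _ => ?_)
  rw [b.repr_apply_apply]
  have hbB : b i ∈ B := hb.subset (Set.mem_range_self i)
  by_cases hbC : b i ∈ C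
  · exact Submodule.smul_mem _ _
      (Submodule.le_topologicalClosure _ (Submodule.subset_span ⟨hbB, hbC⟩))
  · rw [hx _ ⟨hbB, hbC⟩, zero_smul]
    exact Submodule.zero_mem _

end IsHilbertBasisSet

end HilbertBasisSet

section CuntzPair

theorem IsCuntzPair.symm {A : Type*} [Ring A] [StarRing A] {a b : A} (h : IsCuntzPair a b) :
    IsCuntzPair b a :=
  ⟨h.isometry₂, h.isometry₁, (add_comm _ _).trans h.sum_range⟩

theorem IsCuntzPair.star_mul_eq_zero {A : Type*} [Ring A] [StarRing A] {a b : A}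
    (h : IsCuntzPair a b) : star a * b = 0 := by
  have hdouble : star a * b = star a * b + star a * b :=
    calc star a * b
      _ = star a * (a * star a + b * star b) * b := by rw [h.sum_range, mul_one]
      _ = star a * a * (star a * b) + star a * b * (star b * b) := by noncomm_ring
      _ = star a * b + star a * b := by rw [h.isometry₁, h.isometry₂, one_mul, mul_one]
  exact left_eq_add.1 hdouble

variable {𝕜 H : Type*} [RCLike 𝕜] [NormedAddCommGroup H] [InnerProductSpace 𝕜 H] [CompleteSpace H]
  {a b : H →L[𝕜] H} {C P Q : Set H} {x y : H}

namespace IsCuntzPair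

theorem inner_left_left (h : IsCuntzPair a b) (x y : H) : ⟪a x, a y⟫_𝕜 = ⟪x, y⟫_𝕜 :=
  a.inner_map_map_iff_adjoint_comp_self.2 h.isometry₁ x y

theorem inner_right_right (h : IsCuntzPair a b) (x y : H) : ⟪b x, b y⟫_𝕜 = ⟪x, y⟫_𝕜 :=
  h.symm.inner_left_left x y

theorem inner_left_right (h : IsCuntzPair a b) (x y : H) : ⟪a x, b y⟫_𝕜 = 0 := by
  rw [← ContinuousLinearMap.adjoint_inner_right, ← ContinuousLinearMap.star_eq_adjoint,
    ← mul_apply_eq_comp, h.star_mul_eq_zero, zero_apply, inner_zero_right]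

theorem inner_right_left (h : IsCuntzPair a b) (x y : H) : ⟪b x, a y⟫_𝕜 = 0 :=
  h.symm.inner_left_right x y

theorem injective_left (h : IsCuntzPair a b) : Function.Injective a :=
  ((a : H →ₗ[𝕜] H).isometryOfInner h.inner_left_left).injective

theorem injective_right (h : IsCuntzPair a b) : Function.Injective b := h.symm.injective_left

theorem eq_zero_of_left_eq_right (h : IsCuntzPair a b) (hxy : a x = b y) : x = 0 := by
  rw [← inner_self_eq_zero (𝕜 := 𝕜), ← h.inner_left_left]
  nth_rw 2 [hxy]
  exact h.inner_left_right x y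

theorem left_mem_iff (h : IsCuntzPair a b) (hQ : IsSelfSimilar a b Q) (h0 : 0 ∈ Q) (x : H) :
    a x ∈ Q ↔ x ∈ Q := by
  refine ⟨fun hx => ?_, fun hx => hQ.mapsTo_left hx⟩
  rcases hQ.superset hx with ⟨y, hy, hyx⟩ | ⟨y, -, hyx⟩
  · exact h.injective_left hyx ▸ hy
  · exact h.eq_zero_of_left_eq_right hyx.symm ▸ h0

theorem right_mem_iff (h : IsCuntzPair a b) (hQ : IsSelfSimilar a b Q) (h0 : 0 ∈ Q) (x : H) :
    b x ∈ Q ↔ x ∈ Q :=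
  h.symm.left_mem_iff hQ.symm h0 x

theorem inter_iteratedRange_subset_image (h : IsCuntzPair a b) (hP : IsSelfSimilar a b P)
    (h0 : 0 ∉ P) : P ∩ iteratedRange a ⊆ a '' (P ∩ iteratedRange a) := by
  rintro x ⟨hxP, hx⟩
  rcases hP.superset hxP with ⟨y, hy, rfl⟩ | ⟨y, hy, rfl⟩
  · exact ⟨y, ⟨hy, (apply_mem_iteratedRange_iff h.injective_left).1 hx⟩, rfl⟩
  · rw [← image_iteratedRange h.injective_left] at hx
    obtain ⟨z, -, hz⟩ := hx
    exact absurd (h.symm.eq_zero_of_left_eq_right hz.symm ▸ hy) h0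

-- Strip common leading factors `a`; they run out on the side of `x` only.
theorem inner_eq_zero_of_notMem_iteratedRange (h : IsCuntzPair a b) (hP : IsSelfSimilar a b P)
    (hxP : x ∈ P) (hx : x ∉ iteratedRange a) (hy : y ∈ iteratedRange a) : ⟪x, y⟫_𝕜 = 0 := by
  obtain ⟨k, hk⟩ : ∃ k, x ∉ Set.range a^[k] := by simpa [iteratedRange] using hx
  clear hx
  induction k generalizing x y with
  | zero => exact absurd ⟨x, rfl⟩ hk
  | succ k ih =>
    rw [← image_iteratedRange h.injective_left] at hy
    obtain ⟨y, hy, rfl⟩ := hy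
    rcases hP.superset hxP with ⟨x, hx, rfl⟩ | ⟨x, -, rfl⟩
    · rw [h.inner_left_left]
      refine ih hx hy fun ⟨z, hz⟩ => hk ⟨z, ?_⟩
      rw [Function.iterate_succ_apply', hz]
    · exact h.inner_right_left x y

theorem inner_eq_zero_of_mem_branchHull (h : IsCuntzPair a b) (hP : P ⊆ branch a b P)
    (hPC : ∀ x ∈ P, ∀ y ∈ C, ⟪x, y⟫_𝕜 = 0) (hx : x ∈ P) (hy : y ∈ branchHull a b C) :
    ⟪x, y⟫_𝕜 = 0 := by
  let orthogonal : Set H := {y | ∀ x ∈ P, ⟪x, y⟫_𝕜 = 0}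
  suffices branchHull a b C ⊆ orthogonal from this hy x hx
  refine branchHull_subset (fun y hy x hx => hPC x hx y hy) ?_ ?_
  · intro y hy x hx
    rcases hP hx with ⟨z, hz, rfl⟩ | ⟨z, -, rfl⟩
    · exact (h.inner_left_left z y).trans (hy z hz)
    · exact h.inner_right_left z y
  · intro y hy x hx
    rcases hP hx with ⟨z, -, rfl⟩ | ⟨z, hz, rfl⟩
    · exact h.inner_left_right z y
    · exact (h.inner_right_right z y).trans (hy z hz)

theorem orthonormal_branch (h : IsCuntzPair a b) (hC : Orthonormal 𝕜 ((↑) : C → H)) :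
    Orthonormal 𝕜 ((↑) : branch a b C → H) := by
  refine orthonormal_union (orthonormal_image h.inner_left_left hC)
    (orthonormal_image h.inner_right_right hC) ?_
  rintro _ ⟨x, -, rfl⟩ _ ⟨y, -, rfl⟩
  exact h.inner_left_right x y

theorem orthonormal_branchHull (h : IsCuntzPair a b) (hCa : C ⊆ a '' C)
    (hC : Orthonormal 𝕜 ((↑) : C → H)) : Orthonormal 𝕜 ((↑) : branchHull a b C → H) := by
  refine orthonormal_iUnion_of_directed (monotone_iterate_branch hCa).directed_le fun k => ?_
  induction k with
  | zero => exact hC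
  | succ k ih =>
    rw [Function.iterate_succ_apply']
    exact h.orthonormal_branch ih

end IsCuntzPair

end CuntzPair

section TwoAdicPair

theorem IsTwoAdicPair.map {R A B : Type*} [CommSemiring R] [Ring A] [StarRing A] [Algebra R A]
    [Ring B] [StarRing B] [Algebra R B] {u s : A} (h : IsTwoAdicPair u s) (φ : A →⋆ₐ[R] B) :
    IsTwoAdicPair (φ u) (φ s) where
  unitary := Unitary.map_mem φ h.unitary
  isometry := by rw [← map_star, ← map_mul, h.isometry, map_one]
  comm := by rw [← map_mul, h.comm, map_mul, map_pow]
  sum_range := by simp only [← map_star, ← map_mul, ← map_add, h.sum_range, map_one]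

variable {𝕜 H : Type*} [RCLike 𝕜] [NormedAddCommGroup H] [InnerProductSpace 𝕜 H]

/-- The images of the unitary part of `u s` under all words in `u s` and `s`. They span the
reducing subspace generated by that unitary part. -/
def unitaryHull (u s : H →L[𝕜] H) : Set H :=
  branchHull ⇑(u * s) ⇑s (iteratedRange ⇑(u * s))

/-- The part of a basis `E` permuted by `u s` and `s` that is retained in the basis permuted by
`u` and `s`. -/
def retainedPart (u s : H →L[𝕜] H) (E : Set H) : Set H :=
  E \ unitaryHull u s

variable [CompleteSpace H]

/-- The orthonormal basis of the unitary part of `u s` that `u` maps onto the vectors of `E` in the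
unitary part of `s`. -/
def pulledBackPart (u s : H →L[𝕜] H) (E : Set H) : Set H :=
  ⇑(star u) '' (E ∩ iteratedRange s)

/-- The orthonormal basis permuted by `u` and `s`, obtained from a basis `E` permuted by `u s` and
`s` by replacing the vectors of `E` in `unitaryHull u s`. -/
def adaptedBasis (u s : H →L[𝕜] H) (E : Set H) : Set H :=
  retainedPart u s E ∪ branchHull ⇑(u * s) ⇑s (pulledBackPart u s E)

namespace IsTwoAdicPair

variable {u s : H →L[𝕜] H} {E : Set H} {x y : H}

theorem star_apply_apply (h : IsTwoAdicPair u s) (x : H) : star u (u x) = x := by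
  rw [← mul_apply_eq_comp, Unitary.star_mul_self_of_mem h.unitary, one_apply_eq_self]

theorem apply_star_apply (h : IsTwoAdicPair u s) (x : H) : u (star u x) = x := by
  rw [← mul_apply_eq_comp, Unitary.mul_star_self_of_mem h.unitary, one_apply_eq_self]

theorem semiconj (h : IsTwoAdicPair u s) : Function.Semiconj u ⇑(u * s) s := fun x => by
  rw [← mul_apply_eq_comp, ← mul_assoc, ← sq, ← h.comm, mul_apply_eq_comp]

theorem star_semiconj (h : IsTwoAdicPair u s) : Function.Semiconj ⇑(star u) s ⇑(u * s) :=
  h.semiconj.inverse_left h.star_apply_apply h.apply_star_apply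

theorem star_apply_mul_apply (h : IsTwoAdicPair u s) (x : H) : star u ((u * s) x) = s x :=
  h.star_apply_apply (s x)

theorem isSelfSimilar_unitaryHull (h : IsTwoAdicPair u s) :
    IsSelfSimilar ⇑(u * s) ⇑s (unitaryHull u s) :=
  isSelfSimilar_branchHull (image_iteratedRange h.isCuntzPair.injective_left).ge

theorem isSelfSimilar_retainedPart (h : IsTwoAdicPair u s) (hself : IsSelfSimilar ⇑(u * s) ⇑s E) :
    IsSelfSimilar ⇑(u * s) ⇑s (retainedPart u s E) := by
  have hzero : (0 : H) ∈ unitaryHull u s :=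
    subset_branchHull (Set.mem_iInter.2 fun k => ⟨0, Function.iterate_fixed (map_zero _) k⟩)
  exact hself.diff (h.isCuntzPair.left_mem_iff h.isSelfSimilar_unitaryHull hzero)
    (h.isCuntzPair.right_mem_iff h.isSelfSimilar_unitaryHull hzero)

theorem branchHull_pulledBackPart_subset (h : IsTwoAdicPair u s) :
    branchHull ⇑(u * s) ⇑s (pulledBackPart u s E) ⊆ unitaryHull u s :=
  branchHull_mono (Set.mapsTo_iff_image_subset.1
    ((mapsTo_iteratedRange h.star_semiconj).mono_left Set.inter_subset_right))

theorem inner_eq_zero_of_mem_unitaryHull (h : IsTwoAdicPair u s) (hx : x ∈ iteratedRange s)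
    (hy : y ∈ unitaryHull u s) : ⟪x, y⟫_𝕜 = 0 := by
  have himage {z : H} (hz : z ∈ iteratedRange s) : z ∈ s '' iteratedRange s :=
    (image_iteratedRange h.isCuntzPair.injective_right).ge hz
  refine h.isCuntzPair.inner_eq_zero_of_mem_branchHull (fun z hz => .inr (himage hz)) ?_ hx hy
  intro x hx y hy
  obtain ⟨x, -, rfl⟩ := himage hx
  obtain ⟨y, -, rfl⟩ := (image_iteratedRange h.isCuntzPair.injective_left).ge hy
  exact h.isCuntzPair.inner_right_left x y

theorem eq_zero_of_mem_unitaryHull (h : IsTwoAdicPair u s) (hx : x ∈ iteratedRange s)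
    (hxhull : x ∈ unitaryHull u s) : x = 0 :=
  inner_self_eq_zero.1 (h.inner_eq_zero_of_mem_unitaryHull hx hxhull)

theorem countable_adaptedBasis (hE : E.Countable) : (adaptedBasis u s E).Countable :=
  (hE.mono Set.sdiff_subset).union
    (countable_branchHull ((hE.mono Set.inter_subset_left).image ⇑(star u)))

variable (h : IsTwoAdicPair u s) (hE : IsHilbertBasisSet 𝕜 E)
  (hself : IsSelfSimilar ⇑(u * s) ⇑s E)
include h hE

theorem inter_iteratedRange_subset_retainedPart : E ∩ iteratedRange s ⊆ retainedPart u s E :=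
  fun _ hx => ⟨hx.1, fun hxhull =>
    ne_zero_of_mem_orthonormal hE.orthonormal hx.1 (h.eq_zero_of_mem_unitaryHull hx.2 hxhull)⟩

include hself

theorem pulledBackPart_subset_image :
    pulledBackPart u s E ⊆ ⇑(u * s) '' pulledBackPart u s E := by
  rintro _ ⟨x, hx, rfl⟩
  obtain ⟨y, hy, rfl⟩ := h.isCuntzPair.symm.inter_iteratedRange_subset_image hself.symm
    (fun h0 => ne_zero_of_mem_orthonormal hE.orthonormal h0 rfl) hx
  exact ⟨star u y, ⟨y, hy, rfl⟩, (h.star_semiconj y).symm⟩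

theorem isSelfSimilar_adaptedBasis : IsSelfSimilar ⇑(u * s) ⇑s (adaptedBasis u s E) :=
  (h.isSelfSimilar_retainedPart hself).union
    (isSelfSimilar_branchHull (h.pulledBackPart_subset_image hE hself))

theorem orthonormal_adaptedBasis : Orthonormal 𝕜 ((↑) : adaptedBasis u s E → H) := by
  have hretained : Orthonormal 𝕜 ((↑) : retainedPart u s E → H) :=
    hE.orthonormal.comp _ (Set.inclusion_injective Set.sdiff_subset)
  have hpulled : Orthonormal 𝕜 ((↑) : pulledBackPart u s E → H) :=
    orthonormal_image
      (ContinuousLinearMap.inner_map_map_of_mem_unitary (Unitary.star_mem h.unitary))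
      (hE.orthonormal.comp _ (Set.inclusion_injective Set.inter_subset_left))
  refine orthonormal_union hretained (h.isCuntzPair.orthonormal_branchHull
    (h.pulledBackPart_subset_image hE hself) hpulled) fun x hx y hy => ?_
  refine h.isCuntzPair.inner_eq_zero_of_mem_branchHull
    (h.isSelfSimilar_retainedPart hself).superset (fun x hx y hy => ?_) hx
    (h.branchHull_pulledBackPart_subset hy)
  exact h.isCuntzPair.inner_eq_zero_of_notMem_iteratedRange hself hx.1
    (fun hx' => hx.2 (subset_branchHull hx')) hy

theorem iteratedRange_subset_topologicalClosure_span :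
    iteratedRange ⇑(u * s) ⊆ (Submodule.span 𝕜 (pulledBackPart u s E)).topologicalClosure := by
  intro x hx
  have hux : u x ∈ (Submodule.span 𝕜 (E ∩ iteratedRange s)).topologicalClosure :=
    hE.mem_topologicalClosure_span_inter fun y hy =>
      h.isCuntzPair.symm.inner_eq_zero_of_notMem_iteratedRange hself.symm hy.1 hy.2
        (mapsTo_iteratedRange h.semiconj hx)
  rw [← h.star_apply_apply x]
  exact mapsTo_topologicalClosure_span (Set.mapsTo_image _ _) hux

theorem isHilbertBasisSet_adaptedBasis : IsHilbertBasisSet 𝕜 (adaptedBasis u s E) := by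
  refine ⟨h.orthonormal_adaptedBasis hE hself, top_unique ?_⟩
  have hF := h.isSelfSimilar_adaptedBasis hE hself
  have hhull : unitaryHull u s ⊆ (Submodule.span 𝕜 (adaptedBasis u s E)).topologicalClosure :=
    branchHull_subset
      ((h.iteratedRange_subset_topologicalClosure_span hE hself).trans
        (Submodule.topologicalClosure_mono
          (Submodule.span_mono (subset_branchHull.trans Set.subset_union_right))))
      (mapsTo_topologicalClosure_span hF.mapsTo_left)
      (mapsTo_topologicalClosure_span hF.mapsTo_right)
  rw [← hE.topologicalClosure_span]
  refine Submodule.topologicalClosure_minimal _ (Submodule.span_le.2 fun x hx => ?_)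
    (Submodule.isClosed_topologicalClosure _)
  by_cases hxhull : x ∈ unitaryHull u s
  · exact hhull hxhull
  · exact Submodule.le_topologicalClosure _ (Submodule.subset_span (.inl ⟨hx, hxhull⟩))

theorem mapsTo_adaptedBasis : Set.MapsTo u (adaptedBasis u s E) (adaptedBasis u s E) := by
  have hF := h.isSelfSimilar_adaptedBasis hE hself
  rintro x (hx | hx)
  · exact hF.apply_mem_of_notMem_iteratedRange (fun _ => rfl) h.semiconj (.inl hx)
      fun hx' => hx.2 (subset_branchHull hx')
  · suffices branchHull ⇑(u * s) ⇑s (pulledBackPart u s E) ⊆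
        {x | x ∈ adaptedBasis u s E ∧ u x ∈ adaptedBasis u s E} from (this hx).2
    refine branchHull_subset ?_ ?_ ?_
    · rintro _ ⟨y, hy, rfl⟩
      refine ⟨.inr (subset_branchHull ⟨y, hy, rfl⟩), ?_⟩
      rw [h.apply_star_apply]
      exact .inl (h.inter_iteratedRange_subset_retainedPart hE hy)
    · rintro x ⟨hx, hux⟩
      exact ⟨hF.mapsTo_left hx, (h.semiconj x).symm ▸ hF.mapsTo_right hux⟩
    · rintro x ⟨hx, -⟩
      exact ⟨hF.mapsTo_right hx, hF.mapsTo_left hx⟩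

theorem mapsTo_star_adaptedBasis :
    Set.MapsTo ⇑(star u) (adaptedBasis u s E) (adaptedBasis u s E) := by
  intro x hx
  by_cases hxs : x ∈ iteratedRange s
  · rcases hx with hx | hx
    · exact .inr (subset_branchHull ⟨x, ⟨hx.1, hxs⟩, rfl⟩)
    · refine absurd (h.eq_zero_of_mem_unitaryHull hxs (h.branchHull_pulledBackPart_subset hx)) ?_
      exact ne_zero_of_mem_orthonormal (h.orthonormal_adaptedBasis hE hself) (.inr hx)
  · exact (h.isSelfSimilar_adaptedBasis hE hself).symm.apply_mem_of_notMem_iteratedRange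
      h.star_apply_mul_apply h.star_semiconj hx hxs

theorem image_adaptedBasis : u '' adaptedBasis u s E = adaptedBasis u s E :=
  (h.mapsTo_adaptedBasis hE hself).image_subset.antisymm fun x hx =>
    ⟨star u x, h.mapsTo_star_adaptedBasis hE hself hx, h.apply_star_apply x⟩

end IsTwoAdicPair

end TwoAdicPair

section Permutative

theorem exists_injective_of_mapsTo_range {ι α : Type*} {f : ι → α} {u : α → α}
    (hf : Function.Injective f) (hu : Function.Injective u)
    (h : Set.MapsTo u (Set.range f) (Set.range f)) :
    ∃ σ : ι → ι, Function.Injective σ ∧ ∀ i, u (f i) = f (σ i) := by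
  choose σ hσ using fun i => h (Set.mem_range_self i)
  refine ⟨σ, fun i j hij => hf (hu ?_), fun i => (hσ i).symm⟩
  rw [← hσ i, ← hσ j, hij]

theorem exists_bijective_of_image_range_eq {ι α : Type*} {f : ι → α} {u : α → α}
    (hf : Function.Injective f) (hu : Function.Injective u)
    (h : u '' Set.range f = Set.range f) :
    ∃ τ : ι → ι, Function.Bijective τ ∧ ∀ i, u (f i) = f (τ i) := by
  obtain ⟨τ, hτ, huτ⟩ :=
    exists_injective_of_mapsTo_range hf hu (Set.mapsTo_iff_image_subset.2 h.subset)
  refine ⟨τ, ⟨hτ, fun i => ?_⟩, huτ⟩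
  obtain ⟨_, ⟨j, rfl⟩, hj⟩ := h.superset (Set.mem_range_self i)
  exact ⟨j, hf ((huτ j).symm.trans hj)⟩

theorem isSelfSimilar_range {ι α : Type*} {σ₁ σ₂ : ι → ι} {e : ι → α} {f g : α → α}
    (hcover : Set.range σ₁ ∪ Set.range σ₂ = Set.univ) (hf : ∀ i, f (e i) = e (σ₁ i))
    (hg : ∀ i, g (e i) = e (σ₂ i)) : IsSelfSimilar f g (Set.range e) := by
  have hcomp (k : α → α) (σ : ι → ι) (hk : ∀ i, k (e i) = e (σ i)) :
      k '' Set.range e = e '' Set.range σ := by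
    rw [← Set.range_comp, ← Set.range_comp]
    exact congrArg Set.range (funext hk)
  rw [IsSelfSimilar, branch, hcomp f σ₁ hf, hcomp g σ₂ hg, ← Set.image_union, hcover,
    Set.image_univ]

variable {H : Type*} [NormedAddCommGroup H] [InnerProductSpace ℂ H] [CompleteSpace H]

theorem isPermutativeTwoAdic_of_isHilbertBasisSet {ρ : TwoAdicAlgebra →⋆ₐ[ℂ] (H →L[ℂ] H)}
    {F : Set H} (φ : ℕ ≃ F) (hF : IsHilbertBasisSet ℂ F) (hs : Set.MapsTo (ρ twoAdicS) F F)
    (hu : ρ twoAdicU '' F = F) : IsPermutativeTwoAdic ρ := by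
  have h : IsTwoAdicPair (ρ twoAdicU) (ρ twoAdicS) := isTwoAdicPair_twoAdic.map ρ
  obtain ⟨f, rfl⟩ := hF.exists_hilbertBasis_range_eq φ
  have hinj : Function.Injective f := f.orthonormal.linearIndependent.injective
  obtain ⟨σ, hσ, hsσ⟩ := exists_injective_of_mapsTo_range hinj h.isCuntzPair.injective_right hs
  obtain ⟨τ, hτ, huτ⟩ := exists_bijective_of_image_range_eq hinj
    (Function.LeftInverse.injective h.star_apply_apply) hu
  exact ⟨f, σ, τ, hσ, hτ, hsσ, huτ⟩

theorem Extends.exists_isSelfSimilar {ρ : TwoAdicAlgebra →⋆ₐ[ℂ] (H →L[ℂ] H)}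
    {π : CuntzAlgebra →⋆ₐ[ℂ] (H →L[ℂ] H)} (hρ : Extends ρ π) (hπ : IsPermutativeCuntz π) :
    ∃ e : HilbertBasis ℕ ℂ H,
      IsSelfSimilar ⇑(ρ twoAdicU * ρ twoAdicS) ⇑(ρ twoAdicS) (Set.range e) := by
  obtain ⟨e, σ₁, σ₂, hσ, h₁, h₂⟩ := hπ
  have hπ₁ : π cuntzX₁ = ρ twoAdicU * ρ twoAdicS := by
    rw [← hρ, StarAlgHom.comp_apply, inclusion_cuntzX₁, map_mul]
  have hπ₂ : π cuntzX₂ = ρ twoAdicS := by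
    rw [← hρ, StarAlgHom.comp_apply, inclusion_cuntzX₂]
  rw [hπ₁] at h₁
  rw [hπ₂] at h₂
  exact ⟨e, isSelfSimilar_range hσ.cover h₁ h₂⟩

end Permutative

end TwoAdic

open TwoAdic in
theorem mainTheorem3_general {H : Type*} [NormedAddCommGroup H] [InnerProductSpace ℂ H]
    [CompleteSpace H] (π : CuntzAlgebra →⋆ₐ[ℂ] (H →L[ℂ] H)) (hπ : IsPermutativeCuntz π)
    (ρ : TwoAdicAlgebra →⋆ₐ[ℂ] (H →L[ℂ] H)) (hρ : Extends ρ π) : IsPermutativeTwoAdic ρ := by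
  have h : IsTwoAdicPair (ρ twoAdicU) (ρ twoAdicS) := isTwoAdicPair_twoAdic.map ρ
  obtain ⟨e, hself⟩ := hρ.exists_isSelfSimilar hπ
  have hE : IsHilbertBasisSet ℂ (Set.range e) := isHilbertBasisSet_range e
  let F : Set H := adaptedBasis (ρ twoAdicU) (ρ twoAdicS) (Set.range e)
  have hF : IsHilbertBasisSet ℂ F := h.isHilbertBasisSet_adaptedBasis hE hself
  have : Countable F := IsTwoAdicPair.countable_adaptedBasis (Set.countable_range e)
  have : Infinite F := (hF.infinite (not_finiteDimensional_of_hilbertBasis e)).to_subtype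
  obtain ⟨φ⟩ : Nonempty (ℕ ≃ F) := nonempty_equiv_of_countable
  exact isPermutativeTwoAdic_of_isHilbertBasisSet φ hF
    (h.isSelfSimilar_adaptedBasis hE hself).mapsTo_right (h.image_adaptedBasis hE hself)

theorem mainTheorem3 {H : Type*} [NormedAddCommGroup H] [InnerProductSpace ℂ H] [CompleteSpace H]
    (π : TwoAdic.CuntzAlgebra →⋆ₐ[ℂ] (H →L[ℂ] H)) (hπ : TwoAdic.IsPermutativeCuntz π)
    (hext : ∃ ρ : TwoAdic.TwoAdicAlgebra →⋆ₐ[ℂ] (H →L[ℂ] H), TwoAdic.Extends ρ π) :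
    ∃ ρ : TwoAdic.TwoAdicAlgebra →⋆ₐ[ℂ] (H →L[ℂ] H),
      TwoAdic.Extends ρ π ∧ TwoAdic.IsPermutativeTwoAdic ρ := by
  obtain ⟨ρ, hρ⟩ := hext
  exact ⟨ρ, hρ, mainTheorem3_general π hπ ρ hρ⟩
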